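/- Let $\Delta$ be a finite simplicial complex (with $\emptyset\in\Delta$) of dimension $d-1$, where $d\ge 0$. Suppose that $\Delta$ is centrally symmetric, i.e. there is a simplicial involution $\phi:\Delta\to\Delta$ with $\phi(F)\neq F$ for every non-empty face $F\in\Delta$. Suppose also that $\Delta$ is Cohen–Macaulay over $\mathbb{R}$, i.e. whenever $\theta_1,\dots,\theta_d$ are linear forms such that $\mathbb{R}[\Delta]/(\theta_1,\dots,\theta_d)$ is a finite-dimensional real vector space, $\theta_{i+1}$ is a non-zero-divisor on $\mathbb{R}[\Delta]/(\theta_1,\dots,\theta_i)$ for all $0\le i<d$; here $\mathbb{R}[\Delta]$ is the Stanley–Reisner ring of $\Delta$. Then $$h_i(\Delta)\ \ge\ \binom{d}{i}\qquad\text{for all } 0\le i\le d,$$ where the numbers $h_i(\Delta)$ are defined by $\sum_{i=0}^d h_i(\Delta)\,t^i=\sum_{i=0}^d f_{i-1}(\Delta)\,t^i(1-t)^{d-i}$ and $f_{j}(\Delta)$ is the number of $j$-dimensional faces of $\Delta$ (so $f_{-1}(\Delta)=1$). -/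

import Mathlib

/-!
A finite simplicial complex on `V` is given by Mathlib's `PreAbstractSimplicialComplex V` with `V`
finite. Mathlib's structure records only the non-empty faces; the empty face always belongs to the
complex and is added back by `IsFace`. Elements of `V` that are not vertices of the complex are
allowed.
-/

namespace PreAbstractSimplicialComplex

section Combinatorics

variable {V : Type*}

/-- `F` is a face of the complex, the empty face included. -/
def IsFace (K : PreAbstractSimplicialComplex V) (F : Finset V) : Prop :=
  F = ∅ ∨ F ∈ K

/-- The complex admits a simplicial involution that fixes no non-empty face (every `F ∈ K` is
non-empty by the conventions of Mathlib). -/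
def IsCentrallySymmetric (K : PreAbstractSimplicialComplex V) : Prop :=
  ∃ φ : Equiv.Perm V, Function.Involutive φ ∧
    (∀ F ∈ K, F.map φ.toEmbedding ∈ K) ∧
    ∀ F ∈ K, F.map φ.toEmbedding ≠ F

variable [Fintype V]

open Classical in
/-- The finite set of all faces, including the empty one. -/
noncomputable def allFaces (K : PreAbstractSimplicialComplex V) : Finset (Finset V) :=
  Finset.univ.filter fun F => K.IsFace F

/-- The largest number of vertices of a face; this is `d` for a `(d - 1)`-dimensional complex. -/
noncomputable def rank (K : PreAbstractSimplicialComplex V) : ℕ :=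
  K.allFaces.sup Finset.card

/-- The dimension of the complex, the maximum of `|F| - 1` over all faces `F`. -/
noncomputable def dim (K : PreAbstractSimplicialComplex V) : ℤ :=
  (K.rank : ℤ) - 1

/-- The number `f_i` of faces of dimension `i`, for `i ≥ -1`. -/
noncomputable def fNumber (K : PreAbstractSimplicialComplex V) (i : ℤ) : ℕ :=
  (K.allFaces.filter fun F => (F.card : ℤ) - 1 = i).card

/-- The polynomial `∑_{i=0}^d f_{i-1} t^i (1 - t)^{d-i}`, where `d - 1` is the dimension. -/
noncomputable def hPolynomial (K : PreAbstractSimplicialComplex V) : Polynomial ℤ :=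
  ∑ i ∈ Finset.range (K.rank + 1),
    (K.fNumber ((i : ℤ) - 1) : Polynomial ℤ) * Polynomial.X ^ i *
      (1 - Polynomial.X) ^ (K.rank - i)

/-- The `h`-number `h_i`, the coefficient of `t^i` in `∑_{i=0}^d f_{i-1} t^i (1 - t)^{d-i}`. -/
noncomputable def hNumber (K : PreAbstractSimplicialComplex V) (i : ℕ) : ℤ :=
  K.hPolynomial.coeff i

end Combinatorics

section Algebra

variable {V : Type*} (k : Type*) [Field k]

/-- The Stanley–Reisner ideal, generated by the squarefree monomials of the non-faces. -/
noncomputable def stanleyReisnerIdeal (K : PreAbstractSimplicialComplex V) :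
    Ideal (MvPolynomial V k) :=
  Ideal.span {p | ∃ F : Finset V, ¬ K.IsFace F ∧ p = ∏ v ∈ F, MvPolynomial.X v}

/-- The Stanley–Reisner ring `k[Δ]`. -/
abbrev StanleyReisnerRing (K : PreAbstractSimplicialComplex V) : Type _ :=
  MvPolynomial V k ⧸ K.stanleyReisnerIdeal k

variable [Fintype V]

variable {k} in
/-- Linear forms `θ_1, …, θ_d`, where `d - 1` is the dimension of the complex, such that
`k[Δ]/(θ_1, …, θ_d)` is a finite-dimensional vector space. -/
structure IsLSOP (K : PreAbstractSimplicialComplex V)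
    (θ : Fin K.rank → MvPolynomial V k) : Prop where
  isHomogeneous : ∀ i, (θ i).IsHomogeneous 1
  finiteDimensional : FiniteDimensional k
    (K.StanleyReisnerRing k ⧸
      Ideal.span (Set.range fun i => Ideal.Quotient.mk (K.stanleyReisnerIdeal k) (θ i)))

/-- The complex is Cohen–Macaulay over the (infinite) field `k`: for every linear system of
parameters `θ_1, …, θ_d` of `k[Δ]`, each `θ_{i+1}` is a non-zero-divisor on
`k[Δ]/(θ_1, …, θ_i)`. -/
def IsCohenMacaulay (K : PreAbstractSimplicialComplex V) : Prop :=
  ∀ θ : Fin K.rank → MvPolynomial V k, K.IsLSOP θ →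
    RingTheory.Sequence.IsWeaklyRegular (K.StanleyReisnerRing k) (List.ofFn θ)

end Algebra

end PreAbstractSimplicialComplex

/-! The involution acts on the graded ring `ℝ[Δ]`, and the Hilbert series of its `+1` and `-1`
eigenspaces are followed while linear forms are divided out. Their sum is the Hilbert series of
`ℝ[Δ]`, which is `h(t)/(1-t)^d`. Their difference is the trace series, and it equals `1`: the
involution permutes the face monomials freely in positive degree and fixes the monomial `1`
(`signedSeries_stanleyReisnerIdeal_sub`).

A linear system of parameters can be chosen with every `θ_i` negated by the involution
(`exists_isLSOP_rename_eq_neg`). By Cohen–Macaulayness each `θ_i` is a non-zero-divisor modulo the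
earlier ones. Multiplication by it raises degree by one and exchanges the eigenspaces, so dividing
it out multiplies the sum by `1 - t` and the difference by `1 + t` (`signedSeries_partialIdeal`).
After `d` steps the sum is `h(t)` and the difference is `(1+t)^d`. Hence `h_i - (d choose i)` is
twice the dimension of the degree `i` part of the `-1` eigenspace, which is non-negative.

All quotients are kept as ideals of the polynomial ring, and eigenspaces as ranges of explicit
projections. -/

open MvPolynomial

/-! ### Eigenspaces of an involution on functions, and odd functions. -/

/-- The functions on `X` that an involution `s` multiplies by `ε`. -/
def signedFunctions {X : Type*} (s : X → X) (ε : ℝ) : Submodule ℝ (X → ℝ) where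
  carrier := {c | ∀ x, c (s x) = ε * c x}
  add_mem' := by
    intro a b ha hb x
    simp only [Pi.add_apply, ha x, hb x]
    ring
  zero_mem' := by simp
  smul_mem' := by
    intro r a ha x
    simp only [Pi.smul_apply, smul_eq_mul, ha x]
    ring

theorem mem_signedFunctions {X : Type*} {s : X → X} {ε : ℝ} {c : X → ℝ} :
    c ∈ signedFunctions s ε ↔ ∀ x, c (s x) = ε * c x := Iff.rfl

theorem finrank_signedFunctions_add {X : Type*} [Fintype X] {s : X → X}
    (hs : Function.Involutive s) :
    Module.finrank ℝ (signedFunctions s 1) + Module.finrank ℝ (signedFunctions s (-1)) =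
      Fintype.card X := by
  have hsup : signedFunctions s 1 ⊔ signedFunctions s (-1) = ⊤ := by
    rw [eq_top_iff]
    intro c _
    refine Submodule.mem_sup.2 ⟨fun x => (c x + c (s x)) / 2, ?_, fun x => (c x - c (s x)) / 2,
      ?_, ?_⟩
    · intro x
      simp only [hs x]
      ring
    · intro x
      simp only [hs x]
      ring
    · ext x
      simp only [Pi.add_apply]
      ring
  have hinf : signedFunctions s 1 ⊓ signedFunctions s (-1) = ⊥ := by
    rw [eq_bot_iff]
    rintro c ⟨h1, h2⟩
    refine (Submodule.mem_bot ℝ).2 (funext fun x => ?_)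
    have h1 : c (s x) = 1 * c x := h1 x
    have h2 : c (s x) = -1 * c x := h2 x
    simp only [Pi.zero_apply]
    linarith
  have := Submodule.finrank_sup_add_finrank_inf_eq (signedFunctions s 1) (signedFunctions s (-1))
  rw [hsup, hinf, finrank_top, finrank_bot, Module.finrank_fintype_fun_eq_card] at this
  omega

/-- Multiplication by a nowhere vanishing odd function exchanges the two eigenspaces. Using both `ε
= 1` and `ε = -1` gives equal dimensions, so a free involution has trace zero. -/
theorem finrank_signedFunctions_le_neg {X : Type*} [Finite X] {s : X → X}
    (hs : Function.Involutive s) (hfree : ∀ x, s x ≠ x) (ε : ℝ) :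
    Module.finrank ℝ (signedFunctions s ε) ≤ Module.finrank ℝ (signedFunctions s (-ε)) := by
  let e := Finite.equivFin X
  -- An odd sign function: `1` on the smaller point of each orbit, `-1` on the larger.
  let g : X → ℝ := fun x => if e x < e (s x) then 1 else -1
  have hg : ∀ x, g (s x) = - g x := by
    intro x
    have : e x ≠ e (s x) := fun h => hfree x (e.injective h).symm
    rcases lt_or_gt_of_ne this with h | h
    · simp [g, hs x, h, h.not_gt]
    · simp [g, hs x, h, h.not_gt]
  have hg0 : ∀ x, g x ≠ 0 := by
    intro x
    simp only [g]
    split_ifs <;> norm_num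
  let T : signedFunctions s ε →ₗ[ℝ] signedFunctions s (-ε) :=
    { toFun := fun c => ⟨fun x => g x * c.1 x, fun x => by
        have := c.2 x
        simp only [this, hg]
        ring⟩
      map_add' := fun a b => by
        ext x
        simp [mul_add]
      map_smul' := fun r a => by
        ext x
        simp only [Submodule.coe_smul, Pi.smul_apply, smul_eq_mul, RingHom.id_apply]
        ring }
  refine LinearMap.finrank_le_finrank_of_injective (f := T) fun a b hab => ?_
  ext x
  have := congrFun (congrArg Subtype.val hab) x
  exact mul_left_cancel₀ (hg0 x) this

theorem finrank_signedFunctions_neg_one_of_forall_eq {X : Type*} {s : X → X}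
    (hs : ∀ x, s x = x) : Module.finrank ℝ (signedFunctions s (-1)) = 0 := by
  have : signedFunctions s (-1) = ⊥ := by
    rw [eq_bot_iff]
    intro c hc
    refine (Submodule.mem_bot ℝ).2 (funext fun x => ?_)
    have h : c (s x) = -1 * c x := hc x
    rw [hs x] at h
    simp only [Pi.zero_apply]
    linarith
  rw [this, finrank_bot]

/-- Two linear maps with the same kernel have ranges of the same dimension. -/
theorem LinearMap.finrank_range_eq_of_ker_eq {k M N N' : Type*} [Field k] [AddCommGroup M]
    [Module k M] [AddCommGroup N] [Module k N] [AddCommGroup N'] [Module k N']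
    {f : M →ₗ[k] N} {g : M →ₗ[k] N'} (h : LinearMap.ker f = LinearMap.ker g) :
    Module.finrank k (LinearMap.range f) = Module.finrank k (LinearMap.range g) :=
  (f.quotKerEquivRange.symm.trans
    ((Submodule.quotEquivOfEq _ _ h).trans g.quotKerEquivRange)).finrank_eq

/-- A real function on a finite type that is odd under a given involution and otherwise as
injective as possible. -/
theorem exists_odd_of_involutive {V : Type*} [Finite V] {φ : V → V}
    (hφ : Function.Involutive φ) :
    ∃ b : V → ℝ, (∀ v, b (φ v) = - b v) ∧ (∀ v, φ v ≠ v → b v ≠ 0) ∧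
      ∀ v w, φ v ≠ v → b v ^ 2 = b w ^ 2 → w = v ∨ w = φ v := by
  let e : V → ℕ := fun v => (Finite.equivFin V v : ℕ)
  have he : Function.Injective e := Fin.val_injective.comp (Finite.equivFin V).injective
  -- Up to sign, one plus the smaller index in the orbit; the shift by one keeps the value non-zero
  -- at index `0`. Fixed points get `0`.
  let b : V → ℝ := fun v => if e v < e (φ v) then (e v : ℝ) + 1 else
    if e (φ v) < e v then -((e (φ v) : ℝ) + 1) else 0
  have h1 : ∀ v, e v < e (φ v) → b v = (e v : ℝ) + 1 := fun v h => if_pos h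
  have h2 : ∀ v, e (φ v) < e v → b v = -((e (φ v) : ℝ) + 1) := fun v h => by
    simp only [b, if_neg h.not_gt, if_pos h]
  have h3 : ∀ v, e v = e (φ v) → b v = 0 := fun v h => by simp [b, ← h]
  refine ⟨b, fun v => ?_, fun v hv => ?_, fun v w hv hvw => ?_⟩
  · rcases lt_trichotomy (e v) (e (φ v)) with h | h | h
    · rw [h1 v h, h2 (φ v) (by rwa [hφ v]), hφ v]
    · rw [h3 v h, h3 (φ v) (by rw [hφ v, h]), neg_zero]
    · rw [h2 v h, h1 (φ v) (by rwa [hφ v]), neg_neg]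
  · have : e v ≠ e (φ v) := fun h => hv (he h).symm
    rcases lt_or_gt_of_ne this with h | h
    · rw [h1 v h]
      positivity
    · rw [h2 v h, neg_ne_zero]
      positivity
  · have sq : ∀ a c : ℕ, ((a : ℝ) + 1) ^ 2 = ((c : ℝ) + 1) ^ 2 → a = c := by
      intro a c h
      have := (sq_eq_sq₀ (by positivity) (by positivity)).1 h
      exact_mod_cast add_right_cancel this
    have hev : e v ≠ e (φ v) := fun h => hv (he h).symm
    rcases lt_or_gt_of_ne hev with h | h <;> rcases lt_trichotomy (e w) (e (φ w)) with h' | h' | h'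
    · rw [h1 v h, h1 w h'] at hvw
      exact Or.inl (he (sq _ _ hvw)).symm
    · rw [h1 v h, h3 w h'] at hvw
      have : (0 : ℝ) < ((e v : ℝ) + 1) ^ 2 := by positivity
      rw [hvw] at this
      norm_num at this
    · rw [h1 v h, h2 w h', neg_sq] at hvw
      exact Or.inr (by rw [he (sq _ _ hvw), hφ w])
    · rw [h2 v h, h1 w h', neg_sq] at hvw
      exact Or.inr (he (sq _ _ hvw)).symm
    · rw [h2 v h, h3 w h', neg_sq] at hvw
      have : (0 : ℝ) < ((e (φ v) : ℝ) + 1) ^ 2 := by positivity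
      rw [hvw] at this
      norm_num at this
    · rw [h2 v h, h2 w h', neg_sq, neg_sq] at hvw
      exact Or.inl (hφ.injective (he (sq _ _ hvw))).symm

/-! ### Graded eigenspaces of quotients of the polynomial ring. -/

section SignedComponent

variable {V : Type*} (φ : V → V)

/-- The projection to the degree `n` part of the `ε`-eigenspace of the involution of the polynomial
ring that permutes the variables by `φ`. -/
noncomputable def signedComponent (n : ℕ) (ε : ℝ) : MvPolynomial V ℝ →ₗ[ℝ] MvPolynomial V ℝ :=
  (1 / 2 : ℝ) • (homogeneousComponent n + ε • (rename φ).toLinearMap ∘ₗ homogeneousComponent n)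

theorem signedComponent_apply (n : ℕ) (ε : ℝ) (f : MvPolynomial V ℝ) :
    signedComponent φ n ε f = (1 / 2 : ℝ) •
      (homogeneousComponent n f + ε • rename φ (homogeneousComponent n f)) := rfl

variable {φ}

theorem isHomogeneous_signedComponent (n : ℕ) (ε : ℝ) (f : MvPolynomial V ℝ) :
    (signedComponent φ n ε f).IsHomogeneous n := by
  rw [signedComponent_apply, ← mem_homogeneousSubmodule]
  have h := homogeneousComponent_isHomogeneous n f
  exact Submodule.smul_mem _ _ (Submodule.add_mem _ h
    (Submodule.smul_mem _ _ h.rename_isHomogeneous))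

theorem signedComponent_of_isHomogeneous {n : ℕ} {f : MvPolynomial V ℝ} (hf : f.IsHomogeneous n)
    (ε : ℝ) : signedComponent φ n ε f = (1 / 2 : ℝ) • (f + ε • rename φ f) := by
  rw [signedComponent_apply, homogeneousComponent_eq_self hf]

theorem signedComponent_idem (hφ : Function.Involutive φ) (n : ℕ) {ε : ℝ} (hε : ε * ε = 1)
    (f : MvPolynomial V ℝ) :
    signedComponent φ n ε (signedComponent φ n ε f) = signedComponent φ n ε f := by
  rw [signedComponent_of_isHomogeneous (isHomogeneous_signedComponent n ε f),
    signedComponent_apply]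
  set g := homogeneousComponent n f
  have : rename φ (rename φ g) = g := by rw [rename_rename, hφ.comp_self, rename_id_apply]
  simp only [map_smul, map_add, this, smul_add, smul_smul]
  rw [show ε * (1 / 2 * ε) = 1 / 2 by linear_combination (1 / 2) * hε]
  module

theorem homogeneousComponent_mul_of_isHomogeneous {R : Type*} [CommSemiring R] {d : ℕ}
    {θ : MvPolynomial V R}
    (hθ : θ.IsHomogeneous d) (n : ℕ) (g : MvPolynomial V R) :
    homogeneousComponent (n + d) (θ * g) = θ * homogeneousComponent n g := by
  conv_lhs => rw [← sum_homogeneousComponent g, Finset.mul_sum, map_sum]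
  have : ∀ i, homogeneousComponent (n + d) (θ * homogeneousComponent i g) =
      if n = i then θ * homogeneousComponent i g else 0 := by
    intro i
    rw [homogeneousComponent_of_mem (hθ.mul (homogeneousComponent_isHomogeneous i g))]
    refine if_congr ?_ rfl rfl
    omega
  simp only [this, Finset.sum_ite_eq, Finset.mem_range]
  split_ifs with h
  · rfl
  · rw [homogeneousComponent_eq_zero _ _ (by omega), mul_zero]

theorem homogeneousComponent_mul_eq_zero {R : Type*} [CommSemiring R] {d : ℕ}
    {θ : MvPolynomial V R}
    (hθ : θ.IsHomogeneous d) {n : ℕ} (hn : n < d) (g : MvPolynomial V R) :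
    homogeneousComponent n (θ * g) = 0 := by
  rw [← sum_homogeneousComponent g, Finset.mul_sum, map_sum]
  refine Finset.sum_eq_zero fun i _ => ?_
  rw [homogeneousComponent_of_mem (hθ.mul (homogeneousComponent_isHomogeneous i g)),
    if_neg (by omega)]

variable {θ : MvPolynomial V ℝ}

/-- As `θ` is odd, multiplying by it exchanges the eigenspaces; this sign change is the source of
the factor `1 + t` in the trace series. -/
theorem signedComponent_succ_mul (hθ : θ.IsHomogeneous 1) (hφθ : rename φ θ = -θ) (n : ℕ) (ε : ℝ)
    (g : MvPolynomial V ℝ) :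
    signedComponent φ (n + 1) ε (θ * g) = θ * signedComponent φ n (-ε) g := by
  rw [signedComponent_apply, signedComponent_apply, homogeneousComponent_mul_of_isHomogeneous hθ,
    map_mul, hφθ, mul_smul_comm, mul_add, mul_smul_comm, neg_mul, neg_smul, smul_neg]

theorem signedComponent_zero_mul (hθ : θ.IsHomogeneous 1) (ε : ℝ) (g : MvPolynomial V ℝ) :
    signedComponent φ 0 ε (θ * g) = 0 := by
  rw [signedComponent_apply, homogeneousComponent_mul_eq_zero hθ zero_lt_one]
  simp

/-- An ideal is stable if it contains the signed components of its elements. -/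
def IsSignedStable (φ : V → V) (J : Ideal (MvPolynomial V ℝ)) : Prop :=
  ∀ n ε, ∀ f ∈ J, signedComponent φ n ε f ∈ J

theorem mem_sup_span_singleton {R : Type*} [CommRing R] {J : Ideal R} {θ f : R} :
    f ∈ J ⊔ Ideal.span {θ} ↔ ∃ j ∈ J, ∃ g, j + θ * g = f := by
  simp [Submodule.mem_sup, Ideal.mem_span_singleton']
  simp [mul_comm]

theorem IsSignedStable.sup_span_singleton {J : Ideal (MvPolynomial V ℝ)} (hJ : IsSignedStable φ J)
    (hθ : θ.IsHomogeneous 1) (hφθ : rename φ θ = -θ) :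
    IsSignedStable φ (J ⊔ Ideal.span {θ}) := by
  intro n ε f hf
  obtain ⟨j, hj, g, rfl⟩ := mem_sup_span_singleton.1 hf
  rw [map_add]
  rcases n with _ | n
  · rw [signedComponent_zero_mul hθ, add_zero]
    exact Submodule.mem_sup_left (hJ _ _ _ hj)
  · rw [signedComponent_succ_mul hθ hφθ]
    exact mem_sup_span_singleton.2 ⟨_, hJ _ _ _ hj, _, rfl⟩

/-- The signed component, viewed in the quotient by an ideal. -/
noncomputable def signedQuotientMap (φ : V → V) (J : Ideal (MvPolynomial V ℝ)) (n : ℕ) (ε : ℝ) :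
    MvPolynomial V ℝ →ₗ[ℝ] MvPolynomial V ℝ ⧸ J :=
  (Ideal.Quotient.mkₐ ℝ J).toLinearMap ∘ₗ signedComponent φ n ε

theorem signedQuotientMap_apply (J : Ideal (MvPolynomial V ℝ)) (n : ℕ) (ε : ℝ)
    (f : MvPolynomial V ℝ) :
    signedQuotientMap φ J n ε f = Ideal.Quotient.mk J (signedComponent φ n ε f) := rfl

theorem mem_ker_signedQuotientMap {J : Ideal (MvPolynomial V ℝ)} {n : ℕ} {ε : ℝ}
    {f : MvPolynomial V ℝ} :
    f ∈ LinearMap.ker (signedQuotientMap φ J n ε) ↔ signedComponent φ n ε f ∈ J := by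
  rw [LinearMap.mem_ker, signedQuotientMap_apply, Ideal.Quotient.eq_zero_iff_mem]

/-- The dimension of the degree `n` part of the `ε`-eigenspace in the quotient by `J`. -/
noncomputable def signedRank (φ : V → V) (J : Ideal (MvPolynomial V ℝ)) (n : ℕ) (ε : ℝ) : ℕ :=
  Module.finrank ℝ (LinearMap.range (signedQuotientMap φ J n ε))

/-- Ensures that `signedRank` is a true dimension and not the default value `0` of `finrank`. -/
theorem finiteDimensional_range_signedQuotientMap [Finite V] (J : Ideal (MvPolynomial V ℝ))
    (n : ℕ) (ε : ℝ) : FiniteDimensional ℝ (LinearMap.range (signedQuotientMap φ J n ε)) := by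
  have h : FiniteDimensional ℝ ((homogeneousSubmodule V ℝ n).map
      (Ideal.Quotient.mkₐ ℝ J).toLinearMap) :=
    Module.Finite.iff_fg.2 ((homogeneousSubmodule_fg V ℝ n).map _)
  refine Submodule.finiteDimensional_of_le (S₂ := (homogeneousSubmodule V ℝ n).map
      (Ideal.Quotient.mkₐ ℝ J).toLinearMap) ?_
  rintro _ ⟨f, rfl⟩
  exact ⟨_, isHomogeneous_signedComponent n ε f, rfl⟩

theorem signedRank_zero_sup_span_singleton {J : Ideal (MvPolynomial V ℝ)}
    (hφ : Function.Involutive φ) (hJ : IsSignedStable φ J) (hθ : θ.IsHomogeneous 1) {ε : ℝ}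
    (hε : ε * ε = 1) :
    signedRank φ (J ⊔ Ideal.span {θ}) 0 ε = signedRank φ J 0 ε := by
  refine LinearMap.finrank_range_eq_of_ker_eq (Submodule.ext fun f => ?_)
  rw [mem_ker_signedQuotientMap, mem_ker_signedQuotientMap]
  refine ⟨fun h => ?_, fun h => Submodule.mem_sup_left h⟩
  obtain ⟨j, hj, g, h⟩ := mem_sup_span_singleton.1 h
  rw [← signedComponent_idem hφ 0 hε, ← h, map_add, signedComponent_zero_mul hθ, add_zero]
  exact hJ _ _ _ hj

/-- Rank–nullity for the exact sequence `0 → (S/J)_n^{-ε} → (S/J)_{n+1}^{ε} → (S/(J+θ))_{n+1}^{ε} →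
0`, with `S` the polynomial ring, whose first map `m` is multiplication by `θ` and whose second map
`q` is the projection. -/
theorem signedRank_succ_sup_span_singleton [Finite V] {J : Ideal (MvPolynomial V ℝ)}
    (hφ : Function.Involutive φ) (hJ : IsSignedStable φ J) (hθ : θ.IsHomogeneous 1)
    (hφθ : rename φ θ = -θ) (hreg : ∀ g, θ * g ∈ J → g ∈ J) (n : ℕ) {ε : ℝ} (hε : ε * ε = 1) :
    signedRank φ (J ⊔ Ideal.span {θ}) (n + 1) ε + signedRank φ J n (-ε) =
      signedRank φ J (n + 1) ε := by
  have hle : J ≤ J ⊔ Ideal.span {θ} := le_sup_left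
  have hfin := finiteDimensional_range_signedQuotientMap (φ := φ) J (n + 1) ε
  let q : LinearMap.range (signedQuotientMap φ J (n + 1) ε) →ₗ[ℝ]
      MvPolynomial V ℝ ⧸ (J ⊔ Ideal.span {θ}) :=
    (Ideal.Quotient.factorₐ ℝ hle).toLinearMap ∘ₗ Submodule.subtype _
  let m : LinearMap.range (signedQuotientMap φ J n (-ε)) →ₗ[ℝ] MvPolynomial V ℝ ⧸ J :=
    LinearMap.mulLeft ℝ (Ideal.Quotient.mk J θ) ∘ₗ Submodule.subtype _
  have hm : Function.Injective m := by
    rw [← LinearMap.ker_eq_bot, eq_bot_iff]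
    rintro ⟨x, hx⟩ h
    obtain ⟨g, rfl⟩ := Ideal.Quotient.mk_surjective x
    refine (Submodule.mem_bot ℝ).2 (Subtype.ext ?_)
    have h : Ideal.Quotient.mk J θ * Ideal.Quotient.mk J g = 0 := h
    rw [← map_mul, Ideal.Quotient.eq_zero_iff_mem] at h
    exact Ideal.Quotient.eq_zero_iff_mem.2 (hreg g h)
  have hq : LinearMap.range q =
      LinearMap.range (signedQuotientMap φ (J ⊔ Ideal.span {θ}) (n + 1) ε) := by
    ext y
    constructor
    · rintro ⟨⟨_, f, rfl⟩, rfl⟩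
      exact ⟨f, rfl⟩
    · rintro ⟨f, rfl⟩
      exact ⟨⟨_, f, rfl⟩, rfl⟩
  have hker : (LinearMap.ker q).map (Submodule.subtype _) = LinearMap.range m := by
    ext y
    constructor
    · rintro ⟨⟨_, f, rfl⟩, hf, rfl⟩
      have hf : Ideal.Quotient.mk (J ⊔ Ideal.span {θ}) (signedComponent φ (n + 1) ε f) = 0 := hf
      rw [Ideal.Quotient.eq_zero_iff_mem] at hf
      obtain ⟨j, hj, g, h⟩ := mem_sup_span_singleton.1 hf
      -- Projecting the relation `j + θ * g = signedComponent φ (n + 1) ε f` replaces the arbitrary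
      -- cofactor `g` by its component of degree `n` and sign `-ε`.
      have h' := congrArg (signedComponent φ (n + 1) ε) h
      rw [signedComponent_idem hφ _ hε, map_add, signedComponent_succ_mul hθ hφθ] at h'
      refine ⟨⟨_, g, rfl⟩, ?_⟩
      change Ideal.Quotient.mk J θ * Ideal.Quotient.mk J (signedComponent φ n (-ε) g) =
        Ideal.Quotient.mk J (signedComponent φ (n + 1) ε f)
      rw [← map_mul, ← h', map_add, Ideal.Quotient.eq_zero_iff_mem.2 (hJ _ _ _ hj), zero_add]
    · rintro ⟨⟨_, g, rfl⟩, rfl⟩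
      have h : signedQuotientMap φ J (n + 1) ε (θ * g) =
          Ideal.Quotient.mk J θ * Ideal.Quotient.mk J (signedComponent φ n (-ε) g) := by
        rw [signedQuotientMap_apply, signedComponent_succ_mul hθ hφθ, map_mul]
      refine ⟨⟨_, θ * g, rfl⟩, ?_, h⟩
      change Ideal.Quotient.mk (J ⊔ Ideal.span {θ}) (signedComponent φ (n + 1) ε (θ * g)) = 0
      rw [Ideal.Quotient.eq_zero_iff_mem, signedComponent_succ_mul hθ hφθ]
      exact mem_sup_span_singleton.2 ⟨0, zero_mem _, _, zero_add _⟩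
  have h1 := LinearMap.finrank_range_add_finrank_ker q
  have h2 := LinearMap.finrank_range_of_inj hm
  rw [← hker, Submodule.finrank_map_subtype_eq] at h2
  rw [hq, h2] at h1
  exact h1

end SignedComponent

/-! ### The Stanley–Reisner ideal and the action on face monomials. -/

namespace PreAbstractSimplicialComplex

variable {V : Type*} {K : PreAbstractSimplicialComplex V}

theorem IsFace.mono {F G : Finset V} (hF : K.IsFace F) (h : G ⊆ F) : K.IsFace G := by
  rcases G.eq_empty_or_nonempty with hG | hG
  · exact Or.inl hG
  · rcases hF with rfl | hF
    · exact Or.inl (Finset.subset_empty.1 h)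
    · exact Or.inr ((K.isRelLowerSet_faces hF).2 h hG)

/-- The Stanley–Reisner ideal consists of the polynomials all of whose monomials are supported on
non-faces. -/
theorem mem_stanleyReisnerIdeal_iff {k : Type*} [Field k] {f : MvPolynomial V k} :
    f ∈ K.stanleyReisnerIdeal k ↔ ∀ m, K.IsFace m.support → coeff m f = 0 := by
  classical
  have hset : {p : MvPolynomial V k | ∃ F : Finset V, ¬ K.IsFace F ∧ p = ∏ v ∈ F, X v} =
      (fun s => monomial s (1 : k)) ''
        {m | ∃ F : Finset V, ¬ K.IsFace F ∧ m = ∑ v ∈ F, Finsupp.single v 1} := by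
    have h : ∀ F : Finset V, (∏ v ∈ F, X v : MvPolynomial V k) =
        monomial (∑ v ∈ F, Finsupp.single v 1) 1 := fun F => by
      rw [monomial_sum_one]
      rfl
    ext p
    constructor
    · rintro ⟨F, hF, rfl⟩
      exact ⟨_, ⟨F, hF, rfl⟩, (h F).symm⟩
    · rintro ⟨_, ⟨F, hF, rfl⟩, rfl⟩
      exact ⟨F, hF, (h F).symm⟩
  have happ : ∀ (F : Finset V) w, (∑ v ∈ F, Finsupp.single v 1 : V →₀ ℕ) w =
      if w ∈ F then 1 else 0 := fun F w => by
    simp [Finsupp.finsetSum_apply, Finsupp.single_apply]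
  rw [stanleyReisnerIdeal, hset, mem_ideal_span_monomial_image]
  constructor
  · intro h m hm
    by_contra hc
    obtain ⟨_, ⟨F, hF, rfl⟩, hle⟩ := h m (mem_support_iff.2 hc)
    refine hF (hm.mono fun v hv => ?_)
    have := hle v
    rw [happ, if_pos hv] at this
    rw [Finsupp.mem_support_iff]
    omega
  · intro h m hm
    refine ⟨_, ⟨m.support, fun hF => mem_support_iff.1 hm (h m hF), rfl⟩, fun v => ?_⟩
    rw [happ]
    split_ifs with hv
    · rw [Finsupp.mem_support_iff] at hv
      omega
    · exact Nat.zero_le _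

section Symmetric

variable {φ : Equiv.Perm V}

theorem isFace_map (hK : ∀ F ∈ K, F.map φ.toEmbedding ∈ K) {F : Finset V} (hF : K.IsFace F) :
    K.IsFace (F.map φ.toEmbedding) := by
  rcases hF with rfl | hF
  · exact Or.inl (Finset.map_empty _)
  · exact Or.inr (hK F hF)

theorem apply_ne_of_mem_isFace (hne : ∀ F ∈ K, F.map φ.toEmbedding ≠ F) {F : Finset V}
    (hF : K.IsFace F) {v : V} (hv : v ∈ F) : φ v ≠ v := by
  intro h
  have hv' := hF.mono (Finset.singleton_subset_iff.2 hv)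
  refine hne {v} (hv'.resolve_left (Finset.singleton_ne_empty v)) ?_
  simp [h]

/-- Otherwise `{v, φ v}` would be a non-empty face fixed by the involution. -/
theorem apply_notMem_of_mem_isFace (hφ : Function.Involutive φ)
    (hne : ∀ F ∈ K, F.map φ.toEmbedding ≠ F) {F : Finset V}
    (hF : K.IsFace F) {v : V} (hv : v ∈ F) : φ v ∉ F := by
  classical
  intro h
  have hv' : K.IsFace {v, φ v} := hF.mono (by
    intro w hw
    rcases Finset.mem_insert.1 hw with rfl | hw
    · exact hv
    · rwa [Finset.mem_singleton.1 hw])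
  refine hne {v, φ v} (hv'.resolve_left (Finset.insert_ne_empty _ _)) ?_
  simp [Finset.map_insert, hφ v, Finset.pair_comm]

end Symmetric

section FaceMonomials

variable (K) in
/-- The exponents of the monomials of degree `n` that are supported on a face. -/
abbrev FaceMonomial (n : ℕ) : Type _ :=
  {m : V →₀ ℕ // m.degree = n ∧ K.IsFace m.support}

variable {φ : Equiv.Perm V}

theorem degree_equivMapDomain (m : V →₀ ℕ) : (m.equivMapDomain φ).degree = m.degree := by
  rw [Finsupp.equivMapDomain_eq_mapDomain, Finsupp.degree_mapDomain]

/-- The action of a simplicial symmetry on face monomials. -/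
noncomputable def FaceMonomial.map (hK : ∀ F ∈ K, F.map φ.toEmbedding ∈ K) {n : ℕ}
    (m : K.FaceMonomial n) : K.FaceMonomial n :=
  ⟨m.1.equivMapDomain φ, by rw [degree_equivMapDomain, m.2.1], isFace_map hK m.2.2⟩

theorem equivMapDomain_equivMapDomain (hφ : Function.Involutive φ) (m : V →₀ ℕ) :
    (m.equivMapDomain φ).equivMapDomain φ = m := by
  rw [← Finsupp.equivMapDomain_trans]
  have : φ.trans φ = Equiv.refl V := Equiv.ext hφ
  rw [this, Finsupp.equivMapDomain_refl]

theorem FaceMonomial.map_involutive (hφ : Function.Involutive φ)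
    (hK : ∀ F ∈ K, F.map φ.toEmbedding ∈ K) {n : ℕ} :
    Function.Involutive (FaceMonomial.map hK (n := n)) := fun m =>
  Subtype.ext (equivMapDomain_equivMapDomain hφ m.1)

/-- A fixed monomial has a fixed support, which is a non-empty face in positive degree. -/
theorem FaceMonomial.map_ne (hK : ∀ F ∈ K, F.map φ.toEmbedding ∈ K)
    (hne : ∀ F ∈ K, F.map φ.toEmbedding ≠ F) {n : ℕ} (hn : n ≠ 0) (m : K.FaceMonomial n) :
    m.map hK ≠ m := by
  intro h
  have h1 : m.1.equivMapDomain φ = m.1 := congrArg Subtype.val h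
  have h2 : m.1.support.map φ.toEmbedding = m.1.support := congrArg Finsupp.support h1
  rcases m.2.2 with h0 | hF
  · rw [Finsupp.support_eq_empty] at h0
    exact hn (by rw [← m.2.1, h0, map_zero])
  · exact hne _ hF h2

theorem FaceMonomial.map_eq_of_zero (hK : ∀ F ∈ K, F.map φ.toEmbedding ∈ K)
    (m : K.FaceMonomial 0) : m.map hK = m := by
  have h : ∀ m : K.FaceMonomial 0, m.1 = 0 := fun m => (Finsupp.degree_eq_zero_iff m.1).1 m.2.1
  exact Subtype.ext ((h _).trans (h m).symm)

theorem coeff_rename_of_involutive (hφ : Function.Involutive φ) (m : V →₀ ℕ)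
    (f : MvPolynomial V ℝ) : coeff m (rename φ f) = coeff (m.equivMapDomain φ) f := by
  conv_lhs => rw [← equivMapDomain_equivMapDomain hφ m]
  rw [Finsupp.equivMapDomain_eq_mapDomain φ (m.equivMapDomain φ),
    coeff_rename_mapDomain _ φ.injective]

theorem coeff_signedComponent (hφ : Function.Involutive φ) (n : ℕ) (ε : ℝ) (m : V →₀ ℕ)
    (f : MvPolynomial V ℝ) : coeff m (signedComponent φ n ε f) =
      if m.degree = n then (1 / 2) * (coeff m f + ε * coeff (m.equivMapDomain φ) f) else 0 := by
  rw [signedComponent_apply, coeff_smul, coeff_add, coeff_smul, coeff_rename_of_involutive hφ,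
    coeff_homogeneousComponent, coeff_homogeneousComponent, degree_equivMapDomain]
  split_ifs <;> simp

theorem isSignedStable_stanleyReisnerIdeal (hφ : Function.Involutive φ)
    (hK : ∀ F ∈ K, F.map φ.toEmbedding ∈ K) :
    IsSignedStable φ (K.stanleyReisnerIdeal ℝ) := by
  intro n ε f hf
  rw [mem_stanleyReisnerIdeal_iff] at hf ⊢
  intro m hm
  rw [coeff_signedComponent hφ, hf m hm, hf (m.equivMapDomain φ) (isFace_map hK hm)]
  simp

theorem finite_faceMonomial [Finite V] (n : ℕ) : Finite (K.FaceMonomial n) := by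
  classical
  have := Fintype.ofFinite V
  refine Set.Finite.subset (Finset.finite_toSet (Finset.finsuppAntidiag Finset.univ n)) ?_
  rintro m ⟨hm, -⟩
  simp only [Finset.mem_coe, Finset.mem_finsuppAntidiag, Finset.subset_univ, and_true]
  rw [← hm, Finsupp.degree_eq_sum]

/-- The face monomials form a basis of `ℝ[Δ]`. The map `Φ` reads off the coefficients on them; it
has the same kernel as the quotient map, and its range is the eigenspace of functions. -/
theorem signedRank_stanleyReisnerIdeal [Finite V] (hφ : Function.Involutive φ)
    (hK : ∀ F ∈ K, F.map φ.toEmbedding ∈ K) (n : ℕ) {ε : ℝ} (hε : ε * ε = 1) :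
    signedRank φ (K.stanleyReisnerIdeal ℝ) n ε =
      Module.finrank ℝ (signedFunctions (FaceMonomial.map hK (n := n)) ε) := by
  have := finite_faceMonomial (K := K) n
  have := Fintype.ofFinite (K.FaceMonomial n)
  let Φ : MvPolynomial V ℝ →ₗ[ℝ] (K.FaceMonomial n → ℝ) :=
    (LinearMap.pi fun m => lcoeff ℝ m.1) ∘ₗ signedComponent φ n ε
  have hΦ : ∀ f (m : K.FaceMonomial n), Φ f m = coeff m.1 (signedComponent φ n ε f) :=
    fun f m => rfl
  have hrange : LinearMap.range Φ = signedFunctions (FaceMonomial.map hK (n := n)) ε := by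
    ext c
    constructor
    · rintro ⟨f, rfl⟩ m
      rw [hΦ, hΦ, coeff_signedComponent hφ, coeff_signedComponent hφ, if_pos (m.map hK).2.1,
        if_pos m.2.1]
      change 1 / 2 * (coeff (m.1.equivMapDomain φ) f +
        ε * coeff ((m.1.equivMapDomain φ).equivMapDomain φ) f) = _
      rw [equivMapDomain_equivMapDomain hφ]
      linear_combination (-1 / 2 * coeff (m.1.equivMapDomain φ) f) * hε
    · intro hc
      refine ⟨∑ m : K.FaceMonomial n, monomial m.1 (c m), funext fun m => ?_⟩
      have hcoeff : ∀ m' : K.FaceMonomial n,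
          coeff m'.1 (∑ m : K.FaceMonomial n, monomial m.1 (c m)) = c m' := by
        classical
        intro m'
        simp [coeff_sum, coeff_monomial, Subtype.coe_inj]
      have h1 : coeff (m.1.equivMapDomain φ) (∑ m : K.FaceMonomial n, monomial m.1 (c m)) =
        c (m.map hK) := hcoeff (m.map hK)
      rw [hΦ, coeff_signedComponent hφ, if_pos m.2.1, h1, hcoeff, mem_signedFunctions.1 hc]
      linear_combination (1 / 2 * c m) * hε
  rw [← hrange]
  refine LinearMap.finrank_range_eq_of_ker_eq (Submodule.ext fun f => ?_)
  rw [mem_ker_signedQuotientMap, LinearMap.mem_ker, mem_stanleyReisnerIdeal_iff]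
  constructor
  · intro h
    exact funext fun m => h m.1 m.2.2
  · intro h m hm
    by_cases hn : m.degree = n
    · exact congrFun h ⟨m, hn, hm⟩
    · rw [coeff_signedComponent hφ, if_neg hn]

end FaceMonomials

end PreAbstractSimplicialComplex

/-! ### An odd linear system of parameters. -/

namespace PreAbstractSimplicialComplex

variable {V : Type*} {K : PreAbstractSimplicialComplex V}

/-- An algebra generated by finitely many nilpotent elements is finite. -/
theorem finite_of_surjective_of_isNilpotent [Finite V] {k A : Type*} [Field k] [CommRing A]
    [Algebra k A] (π : MvPolynomial V k →ₐ[k] A) (hπ : Function.Surjective π)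
    (hX : ∀ v, IsNilpotent (π (X v))) : Module.Finite k A := by
  have hint : Algebra.IsIntegral k A := by
    refine ⟨fun a => ?_⟩
    obtain ⟨f, rfl⟩ := hπ a
    induction f using MvPolynomial.induction_on with
    | C r => exact (π.commutes r).symm ▸ isIntegral_algebraMap
    | add p q hp hq => exact (map_add π p q).symm ▸ hp.add hq
    | mul_X p v hp =>
      rw [map_mul]
      obtain ⟨n, hn⟩ := hX v
      exact hp.mul ⟨Polynomial.X ^ n, Polynomial.monic_X_pow n, by simp [hn]⟩
  have hft : Algebra.FiniteType k A := Algebra.FiniteType.of_surjective π hπ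
  exact Algebra.IsIntegral.finite

/-- Linear forms are a system of parameters if every prime ideal that contains them and the
Stanley–Reisner ideal contains all variables. -/
theorem isLSOP_of_forall_isPrime [Fintype V] {k : Type*} [Field k]
    {θ : Fin K.rank → MvPolynomial V k} (hhom : ∀ i, (θ i).IsHomogeneous 1)
    (h : ∀ P : Ideal (MvPolynomial V k), P.IsPrime → K.stanleyReisnerIdeal k ≤ P →
      (∀ i, θ i ∈ P) → ∀ v, X v ∈ P) : K.IsLSOP θ := by
  refine ⟨hhom, ?_⟩
  set L := Ideal.span (Set.range fun i => Ideal.Quotient.mk (K.stanleyReisnerIdeal k) (θ i))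
  let A := K.StanleyReisnerRing k ⧸ L
  let _ : CommRing A := Ideal.Quotient.commRing L
  let _ : Algebra k A := Ideal.Quotient.algebra k
  let π : MvPolynomial V k →ₐ[k] A :=
    (Ideal.Quotient.mkₐ k L).comp (Ideal.Quotient.mkₐ k (K.stanleyReisnerIdeal k))
  have hπ : Function.Surjective π :=
    Ideal.Quotient.mk_surjective.comp Ideal.Quotient.mk_surjective
  suffices h : ∀ v, IsNilpotent (π (X v)) from finite_of_surjective_of_isNilpotent π hπ h
  intro v
  -- A nilpotent element is one lying in every prime; primes of the quotient are pulled back to the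
  -- polynomial ring.
  refine nilpotent_iff_mem_prime.2 fun Q hQ => ?_
  let p := Q.comap (Ideal.Quotient.mk _)
  have hp : p.IsPrime := hQ.comap _
  refine h (p.comap (Ideal.Quotient.mk _)) (hp.comap _) (fun f hf => ?_) (fun i => ?_) v
  · rw [Ideal.mem_comap, Ideal.Quotient.eq_zero_iff_mem.2 hf]
    exact zero_mem p
  · have hi : Ideal.Quotient.mk (K.stanleyReisnerIdeal k) (θ i) ∈ L :=
      Ideal.subset_span ⟨i, rfl⟩
    rw [Ideal.mem_comap, Ideal.mem_comap, Ideal.Quotient.eq_zero_iff_mem.2 hi]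
    exact zero_mem Q

theorem card_le_rank [Fintype V] {F : Finset V} (hF : K.IsFace F) : F.card ≤ K.rank :=
  Finset.le_sup (f := Finset.card) (by simpa [allFaces] using hF)

/-- A centrally symmetric complex has a linear system of parameters consisting of forms that the
involution negates. -/
theorem exists_isLSOP_rename_eq_neg [Fintype V] {φ : Equiv.Perm V} (hφ : Function.Involutive φ)
    (hne : ∀ F ∈ K, F.map φ.toEmbedding ≠ F) :
    ∃ θ : Fin K.rank → MvPolynomial V ℝ, K.IsLSOP θ ∧ ∀ i, rename φ (θ i) = -θ i := by
  classical
  obtain ⟨b, hodd, hb0, hinj⟩ := exists_odd_of_involutive hφ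
  -- Only odd powers of `b v` occur, so each form is odd; the powers of `b v ^ 2` set up a
  -- Vandermonde system.
  let θ : Fin K.rank → MvPolynomial V ℝ := fun i => ∑ v, C (b v * (b v ^ 2) ^ (i : ℕ)) * X v
  refine ⟨θ, isLSOP_of_forall_isPrime (fun i => ?_) ?_, fun i => ?_⟩
  · exact IsHomogeneous.sum _ _ _ fun v _ => isHomogeneous_C_mul_X _ _
  · intro P hP hI hθ v
    -- The variables outside `P` form a face, since their product is not in the prime `P`.
    let F : Finset V := Finset.univ.filter fun v => X v ∉ P
    have hF : K.IsFace F := by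
      by_contra hF
      have : (∏ v ∈ F, X v : MvPolynomial V ℝ) ∈ P := hI (Ideal.subset_span ⟨F, hF, rfl⟩)
      obtain ⟨w, hw, hwP⟩ := hP.prod_mem_iff.1 this
      exact (Finset.mem_filter.1 hw).2 hwP
    by_contra hv
    have hvF : v ∈ F := Finset.mem_filter.2 ⟨Finset.mem_univ _, hv⟩
    let e := F.equivFin
    have hCinj : Function.Injective fun r : ℝ => Ideal.Quotient.mk P (C r) :=
      ((Ideal.Quotient.mk P).comp C).injective
    -- Vandermonde in the domain modulo `P`, with unknowns `b v * X v` and nodes `b v ^ 2` for `v ∈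
    -- F`. The nodes are distinct because a face contains no antipodal pair, and there are enough
    -- equations because `F.card ≤ K.rank`.
    have hzero := Matrix.eq_zero_of_forall_pow_sum_mul_pow_eq_zero
      (v := fun j => Ideal.Quotient.mk P (C (b (e.symm j)) * X (e.symm j : V)))
      (f := fun j => Ideal.Quotient.mk P (C (b (e.symm j) ^ 2))) (fun j j' hjj => by
        have h := hCinj hjj
        rcases hinj _ _ (apply_ne_of_mem_isFace hne hF (e.symm j).2) h with h | h
        · exact (e.symm.injective (Subtype.ext h)).symm
        · exact absurd (h ▸ (e.symm j').2) (apply_notMem_of_mem_isFace hφ hne hF (e.symm j).2))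
      (fun i => by
        have hi : (i : ℕ) < K.rank := i.2.trans_le (card_le_rank hF)
        have h := Ideal.Quotient.eq_zero_iff_mem.2 (hθ ⟨i, hi⟩)
        rw [map_sum, ← Finset.sum_subset (Finset.subset_univ F) (fun w _ hw => by
          have : X w ∈ P := by simpa [F] using hw
          rw [map_mul, Ideal.Quotient.eq_zero_iff_mem.2 this, mul_zero]),
          ← Finset.sum_coe_sort, ← e.symm.sum_comp] at h
        rw [← h]
        refine Finset.sum_congr rfl fun j _ => ?_
        rw [← map_pow, ← map_mul]
        congr 1
        simp only [map_mul, map_pow]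
        ring)
    have h := congrFun hzero (e ⟨v, hvF⟩)
    simp only [Equiv.symm_apply_apply, Pi.zero_apply] at h
    rw [Ideal.Quotient.eq_zero_iff_mem] at h
    rcases hP.mem_or_mem h with h | h
    · have hu : IsUnit (C (b v) : MvPolynomial V ℝ) :=
        (isUnit_iff_ne_zero.2 (hb0 v (apply_ne_of_mem_isFace hne hF hvF))).map C
      exact hP.ne_top (Ideal.eq_top_of_isUnit_mem _ h hu)
    · exact hv h
  · simp only [θ, map_sum, map_mul, rename_C, rename_X]
    rw [← Finset.sum_neg_distrib, ← Equiv.sum_comp φ]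
    refine Finset.sum_congr rfl fun v _ => ?_
    rw [hφ v, hodd]
    simp

/-! ### Ideals generated by initial segments of a regular sequence. -/

section Flag

variable {k : Type*} [Field k]

variable (K) in
/-- The ideal generated by the Stanley–Reisner ideal and the first `j` members of a list. -/
noncomputable def partialIdeal (l : List (MvPolynomial V k)) (j : ℕ) : Ideal (MvPolynomial V k) :=
  K.stanleyReisnerIdeal k ⊔ Ideal.ofList (l.take j)

theorem partialIdeal_zero (l : List (MvPolynomial V k)) :
    K.partialIdeal l 0 = K.stanleyReisnerIdeal k := by
  simp [partialIdeal]

theorem partialIdeal_succ (l : List (MvPolynomial V k)) {j : ℕ} (hj : j < l.length) :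
    K.partialIdeal l (j + 1) = K.partialIdeal l j ⊔ Ideal.span {l[j]} := by
  rw [partialIdeal, List.take_add_one, Ideal.ofList_append, ← sup_assoc,
    List.getElem?_eq_getElem hj]
  simp [partialIdeal]

/-- Transfers regularity from successive quotients of the module `k[Δ]` to ideals of the polynomial
ring, where the dimension count takes place. -/
theorem mem_partialIdeal_of_mul_mem {l : List (MvPolynomial V k)}
    (hl : RingTheory.Sequence.IsWeaklyRegular (K.StanleyReisnerRing k) l) {j : ℕ}
    (hj : j < l.length) {g : MvPolynomial V k} (hg : l[j] * g ∈ K.partialIdeal l j) :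
    g ∈ K.partialIdeal l j := by
  have key : ∀ f : MvPolynomial V k, f ∈ K.partialIdeal l j ↔
      (Submodule.Quotient.mk (Ideal.Quotient.mk (K.stanleyReisnerIdeal k) f) :
        K.StanleyReisnerRing k ⧸ (Ideal.ofList (l.take j) • ⊤ :
          Submodule (MvPolynomial V k) (K.StanleyReisnerRing k))) = 0 := by
    intro f
    have h : (Ideal.ofList (l.take j) • ⊤ :
        Submodule (MvPolynomial V k) (K.StanleyReisnerRing k)) =
        Submodule.map (K.stanleyReisnerIdeal k).mkQ (Ideal.ofList (l.take j)) := by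
      rw [← Submodule.range_mkQ (K.stanleyReisnerIdeal k), LinearMap.range_eq_map,
        ← Submodule.map_smul'']
      simp
    rw [Submodule.Quotient.mk_eq_zero, h, partialIdeal, ← Submodule.comap_map_mkQ]
    rfl
  rw [key] at hg ⊢
  refine hl.regular_mod_prev j hj ?_
  simp only [smul_zero]
  rw [← hg, ← Submodule.Quotient.mk_smul]
  rfl

end Flag

end PreAbstractSimplicialComplex

/-! ### The Hilbert series of the Stanley–Reisner ring and the `h`-polynomial. -/

namespace PreAbstractSimplicialComplex

variable {V : Type*} {K : PreAbstractSimplicialComplex V}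

section Hilbert

/-- The generating function of the face monomials with a given support. -/
theorem coeff_prod_mk_ite [DecidableEq V] (F : Finset V) (n : ℕ) :
    PowerSeries.coeff n (∏ _v ∈ F, PowerSeries.mk fun n => if n = 0 then (0 : ℤ) else 1) =
      ((F.finsuppAntidiag n).filter fun m => m.support = F).card := by
  rw [PowerSeries.coeff_prod, Finset.card_filter]
  push_cast
  refine Finset.sum_congr rfl fun m hm => ?_
  simp only [PowerSeries.coeff_mk]
  have hsub := (Finset.mem_finsuppAntidiag.1 hm).2
  split_ifs with h
  · refine Finset.prod_eq_one fun v hv => ?_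
    rw [← h, Finsupp.mem_support_iff] at hv
    rw [if_neg hv]
  · obtain ⟨v, hv, hvm⟩ := Finset.exists_of_ssubset (hsub.ssubset_of_ne h)
    exact Finset.prod_eq_zero hv (if_pos (Finsupp.notMem_support_iff.1 hvm))

/-- Each factor is `t + t^2 + ⋯ = t/(1-t)`. -/
theorem one_sub_X_pow_mul_prod (F : Finset V) :
    (1 - PowerSeries.X) ^ F.card *
      (∏ _v ∈ F, PowerSeries.mk fun n => if n = 0 then (0 : ℤ) else 1) =
        PowerSeries.X ^ F.card := by
  have h : (1 - PowerSeries.X) * (PowerSeries.mk fun n => if n = 0 then (0 : ℤ) else 1) =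
      PowerSeries.X := by
    ext n
    rw [sub_mul, one_mul, map_sub, PowerSeries.coeff_X]
    rcases n with _ | n
    · simp
    · rw [PowerSeries.coeff_succ_X_mul]
      rcases n with _ | n <;> simp
  rw [Finset.prod_const, ← mul_pow, h]

theorem card_faceMonomial_zero : Nat.card (K.FaceMonomial 0) = 1 := by
  rw [Nat.card_eq_one_iff_unique]
  refine ⟨⟨fun m m' => Subtype.ext ?_⟩, ⟨⟨0, map_zero _, Or.inl rfl⟩⟩⟩
  rw [(Finsupp.degree_eq_zero_iff m.1).1 m.2.1, (Finsupp.degree_eq_zero_iff m'.1).1 m'.2.1]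

variable [Fintype V]

theorem mem_allFaces {F : Finset V} : F ∈ K.allFaces ↔ K.IsFace F := by
  simp [allFaces]

/-- Face monomials are sorted by their support. -/
theorem mk_card_faceMonomial :
    (PowerSeries.mk fun n => (Nat.card (K.FaceMonomial n) : ℤ)) =
      ∑ F ∈ K.allFaces, ∏ _v ∈ F, PowerSeries.mk fun n => if n = 0 then (0 : ℤ) else 1 := by
  classical
  ext n
  rw [map_sum]
  simp only [coeff_prod_mk_ite, PowerSeries.coeff_mk]
  rw [← Nat.cast_sum, ← Finset.card_biUnion]
  · congr 1
    refine Nat.subtype_card _ fun m => ?_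
    simp only [Finset.mem_biUnion, mem_allFaces, Finset.mem_filter, Finset.mem_finsuppAntidiag]
    constructor
    · rintro ⟨F, hF, ⟨h1, -⟩, rfl⟩
      exact ⟨h1, hF⟩
    · rintro ⟨h1, h2⟩
      exact ⟨_, h2, ⟨h1, subset_rfl⟩, rfl⟩
  · intro F _ G _ hFG
    rw [Function.onFun, Finset.disjoint_left]
    intro m hm hm'
    exact hFG ((Finset.mem_filter.1 hm).2.symm.trans (Finset.mem_filter.1 hm').2)

theorem one_sub_X_pow_rank_mul_card_faceMonomial :
    (1 - PowerSeries.X : PowerSeries ℤ) ^ K.rank *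
      (PowerSeries.mk fun n => (Nat.card (K.FaceMonomial n) : ℤ)) =
        (K.hPolynomial : PowerSeries ℤ) := by
  classical
  rw [mk_card_faceMonomial, Finset.mul_sum]
  have h : ∀ F ∈ K.allFaces, (1 - PowerSeries.X : PowerSeries ℤ) ^ K.rank *
      (∏ _v ∈ F, PowerSeries.mk fun n => if n = 0 then (0 : ℤ) else 1) =
        PowerSeries.X ^ F.card * (1 - PowerSeries.X) ^ (K.rank - F.card) := by
    intro F hF
    have hle := card_le_rank (mem_allFaces.1 hF)
    conv_lhs => rw [← Nat.sub_add_cancel hle, pow_add, mul_assoc, one_sub_X_pow_mul_prod]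
    rw [mul_comm]
  rw [Finset.sum_congr rfl h, ← Finset.sum_fiberwise_of_maps_to (g := Finset.card)
    (t := Finset.range (K.rank + 1)) fun F hF =>
      Finset.mem_range_succ_iff.2 (card_le_rank (mem_allFaces.1 hF)), hPolynomial,
    ← Polynomial.coeToPowerSeries.ringHom_apply, map_sum]
  refine Finset.sum_congr rfl fun i _ => ?_
  rw [Finset.sum_congr rfl (g := fun _ => PowerSeries.X ^ i * (1 - PowerSeries.X) ^ (K.rank - i))
    fun F hF => by rw [(Finset.mem_filter.1 hF).2]]
  have hf : K.fNumber ((i : ℤ) - 1) = (K.allFaces.filter fun F => F.card = i).card := by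
    rw [fNumber]
    congr 1
    refine Finset.filter_congr fun F _ => ?_
    omega
  rw [Finset.sum_const, hf, nsmul_eq_mul, map_mul, map_mul, map_natCast, mul_assoc]
  simp

end Hilbert

/-! ### Hilbert series of the two eigenspaces. -/

section SignedSeries

variable (φ : V → V)

/-- The Hilbert series of the `ε`-eigenspace of the quotient by `J`. -/
noncomputable def signedSeries (J : Ideal (MvPolynomial V ℝ)) (ε : ℝ) : PowerSeries ℤ :=
  PowerSeries.mk fun n => (signedRank φ J n ε : ℤ)

variable {φ}

theorem signedSeries_sup_span_singleton [Finite V] {J : Ideal (MvPolynomial V ℝ)}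
    {θ : MvPolynomial V ℝ} (hφ : Function.Involutive φ) (hJ : IsSignedStable φ J)
    (hθ : θ.IsHomogeneous 1) (hφθ : rename φ θ = -θ) (hreg : ∀ g, θ * g ∈ J → g ∈ J) {ε : ℝ}
    (hε : ε * ε = 1) :
    signedSeries φ (J ⊔ Ideal.span {θ}) ε =
      signedSeries φ J ε - PowerSeries.X * signedSeries φ J (-ε) := by
  rw [eq_sub_iff_add_eq]
  ext n
  rw [map_add]
  rcases n with _ | n
  · rw [PowerSeries.coeff_zero_X_mul, add_zero, signedSeries, signedSeries, PowerSeries.coeff_mk,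
      PowerSeries.coeff_mk, signedRank_zero_sup_span_singleton hφ hJ hθ hε]
  · rw [PowerSeries.coeff_succ_X_mul, signedSeries, signedSeries, signedSeries,
      PowerSeries.coeff_mk, PowerSeries.coeff_mk, PowerSeries.coeff_mk,
      ← signedRank_succ_sup_span_singleton hφ hJ hθ hφθ hreg n hε, Nat.cast_add]

variable [Finite V] {φ : Equiv.Perm V}

theorem signedSeries_stanleyReisnerIdeal_add (hφ : Function.Involutive φ)
    (hK : ∀ F ∈ K, F.map φ.toEmbedding ∈ K) :
    signedSeries φ (K.stanleyReisnerIdeal ℝ) 1 + signedSeries φ (K.stanleyReisnerIdeal ℝ) (-1) =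
      PowerSeries.mk fun n => (Nat.card (K.FaceMonomial n) : ℤ) := by
  ext n
  have := finite_faceMonomial (K := K) n
  have := Fintype.ofFinite (K.FaceMonomial n)
  rw [map_add, signedSeries, signedSeries, PowerSeries.coeff_mk, PowerSeries.coeff_mk,
    PowerSeries.coeff_mk, signedRank_stanleyReisnerIdeal hφ hK n (by norm_num),
    signedRank_stanleyReisnerIdeal hφ hK n (by norm_num), Nat.card_eq_fintype_card,
    ← finrank_signedFunctions_add (FaceMonomial.map_involutive hφ hK), Nat.cast_add]

/-- The trace series: freeness cancels every positive degree, and degree `0` holds only the fixed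
monomial `1`. -/
theorem signedSeries_stanleyReisnerIdeal_sub (hφ : Function.Involutive φ)
    (hK : ∀ F ∈ K, F.map φ.toEmbedding ∈ K) (hne : ∀ F ∈ K, F.map φ.toEmbedding ≠ F) :
    signedSeries φ (K.stanleyReisnerIdeal ℝ) 1 - signedSeries φ (K.stanleyReisnerIdeal ℝ) (-1) =
      1 := by
  ext n
  have := finite_faceMonomial (K := K) n
  have := Fintype.ofFinite (K.FaceMonomial n)
  rw [map_sub, signedSeries, signedSeries, PowerSeries.coeff_mk, PowerSeries.coeff_mk,
    PowerSeries.coeff_one, signedRank_stanleyReisnerIdeal hφ hK n (by norm_num),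
    signedRank_stanleyReisnerIdeal hφ hK n (by norm_num)]
  have hinv := FaceMonomial.map_involutive hφ hK (n := n)
  split_ifs with hn
  · subst hn
    have h1 := finrank_signedFunctions_add hinv
    have h2 := finrank_signedFunctions_neg_one_of_forall_eq (FaceMonomial.map_eq_of_zero hK)
    rw [← Nat.card_eq_fintype_card, card_faceMonomial_zero] at h1
    omega
  · have hfree := FaceMonomial.map_ne hK hne hn
    have h1 := finrank_signedFunctions_le_neg hinv hfree 1
    have h2 := finrank_signedFunctions_le_neg hinv hfree (-1)
    rw [neg_neg] at h2
    omega

end SignedSeries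

/-- The Hilbert series of the quotients by the initial segments of a regular sequence of linear
forms that the involution negates. -/
theorem signedSeries_partialIdeal [Finite V] {φ : Equiv.Perm V} (hφ : Function.Involutive φ)
    (hK : ∀ F ∈ K, F.map φ.toEmbedding ∈ K) (hne : ∀ F ∈ K, F.map φ.toEmbedding ≠ F)
    {l : List (MvPolynomial V ℝ)} (hhom : ∀ θ ∈ l, θ.IsHomogeneous 1)
    (hneg : ∀ θ ∈ l, rename φ θ = -θ)
    (hreg : RingTheory.Sequence.IsWeaklyRegular (K.StanleyReisnerRing ℝ) l) (j : ℕ)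
    (hj : j ≤ l.length) :
    IsSignedStable φ (K.partialIdeal l j) ∧
      signedSeries φ (K.partialIdeal l j) 1 + signedSeries φ (K.partialIdeal l j) (-1) =
        (1 - PowerSeries.X) ^ j * PowerSeries.mk (fun n => (Nat.card (K.FaceMonomial n) : ℤ)) ∧
      signedSeries φ (K.partialIdeal l j) 1 - signedSeries φ (K.partialIdeal l j) (-1) =
        (1 + PowerSeries.X) ^ j := by
  induction j with
  | zero =>
    rw [partialIdeal_zero, pow_zero, pow_zero, one_mul]
    exact ⟨isSignedStable_stanleyReisnerIdeal hφ hK, signedSeries_stanleyReisnerIdeal_add hφ hK,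
      signedSeries_stanleyReisnerIdeal_sub hφ hK hne⟩
  | succ j ih =>
    obtain ⟨h1, h2, h3⟩ := ih (by omega)
    have hθ := hhom _ (List.getElem_mem hj)
    have hφθ := hneg _ (List.getElem_mem hj)
    have hr : ∀ g, l[j] * g ∈ K.partialIdeal l j → g ∈ K.partialIdeal l j :=
      fun g => mem_partialIdeal_of_mul_mem hreg hj
    have e1 := signedSeries_sup_span_singleton hφ h1 hθ hφθ hr (ε := 1) (by norm_num)
    have e2 := signedSeries_sup_span_singleton hφ h1 hθ hφθ hr (ε := -1) (by norm_num)
    rw [neg_neg] at e2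
    rw [partialIdeal_succ l hj]
    -- With eigenspace series `A` and `B`, the new pair is `A - tB` and `B - tA`: the sum gains the
    -- factor `1 - t`, the difference `1 + t`.
    refine ⟨h1.sup_span_singleton hθ hφθ, ?_, ?_⟩
    · rw [e1, e2, pow_succ', mul_assoc, ← h2]
      ring
    · rw [e1, e2, pow_succ', ← h3]
      ring

end PreAbstractSimplicialComplex

open PreAbstractSimplicialComplex in
theorem theorem7p4 {V : Type*} [Fintype V] (K : PreAbstractSimplicialComplex V) (d : ℕ)
    (hdim : K.dim = (d : ℤ) - 1) (hcs : K.IsCentrallySymmetric) (hCM : K.IsCohenMacaulay ℝ) :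
    ∀ i : ℕ, (d.choose i : ℤ) ≤ K.hNumber i := by
  intro i
  obtain ⟨φ, hφ, hK, hne⟩ := hcs
  obtain ⟨θ, hθ, hneg⟩ := exists_isLSOP_rename_eq_neg hφ hne
  have hd : K.rank = d := by
    rw [dim] at hdim
    omega
  obtain ⟨-, h1, h2⟩ := signedSeries_partialIdeal hφ hK hne
    (l := List.ofFn θ) (by simpa [List.mem_ofFn] using hθ.isHomogeneous)
    (by simpa [List.mem_ofFn] using hneg) (hCM θ hθ) K.rank (by simp)
  rw [one_sub_X_pow_rank_mul_card_faceMonomial] at h1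
  have h1 := congrArg (PowerSeries.coeff i) h1
  have h2 := congrArg (PowerSeries.coeff i) h2
  have h3 : PowerSeries.coeff i ((1 + PowerSeries.X) ^ K.rank : PowerSeries ℤ) = d.choose i := by
    have := Polynomial.coeff_coe ((1 + Polynomial.X) ^ K.rank : Polynomial ℤ) i
    rw [Polynomial.coeff_one_add_X_pow] at this
    rw [← hd, ← this]
    simp
  rw [map_add, Polynomial.coeff_coe] at h1
  rw [map_sub, h3] at h2
  have h4 : 0 ≤ PowerSeries.coeff i
      (signedSeries φ (K.partialIdeal (List.ofFn θ) K.rank) (-1)) := by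
    rw [signedSeries, PowerSeries.coeff_mk]
    positivity
  rw [hNumber]
  -- With `a` and `b` the coefficients of the two eigenspace series, `h_i = a + b` and `(d choose i)
  -- = a - b`, while `b ≥ 0`.
  omega
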